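/- Let $G$ be a group. A subset $S\subseteq G$ is called *elementary algebraic* if there are an integer $n>0$, elements $a_1,\dots,a_n\in G$ and exponents $\varepsilon_1,\dots,\varepsilon_n\in\{-1,1\}$ such that $$S=\{x\in G: x^{\varepsilon_1}a_1x^{\varepsilon_2}a_2\cdots a_{n-1}x^{\varepsilon_n}=a_n\};$$ *algebraic* if $S$ is an intersection of finite unions of elementary algebraic subsets of $G$ (empty unions and the empty intersection, equal to $G$, being allowed); and *unconditionally closed* if $S$ is closed in every Hausdorff group topology on $G$. The *Zariski topology* $\mathfrak Z_G$ is the topology on $G$ whose closed sets are exactly the algebraic subsets of $G$. The *Markov topology* $\mathfrak M_G$ is the intersection of all Hausdorff group topologies on $G$; its closed sets are exactly the unconditionally closed subsets of $G$. If $G$ is an Abelian group, then $\mathfrak M_G=\mathfrak Z_G$. -/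

import Mathlib

namespace MarkovZariski

universe u

variable {G : Type u} [Group G]

/-- The solution set in `G` of the one-variable equation
`x ^ ε₀ * a₀ * x ^ ε₁ * a₁ * ⋯ * aₙ₋₁ * x ^ εₙ = aₙ` with coefficients `aᵢ` in `G` and exponents
`εᵢ ∈ {1, -1}`. -/
def solutionSet (n : ℕ) (a : Fin (n + 1) → G) (ε : Fin (n + 1) → ℤˣ) : Set G :=
  {x | (List.ofFn fun i : Fin n => x ^ (ε i.castSucc : ℤ) * a i.castSucc).prod
        * x ^ (ε (Fin.last n) : ℤ) = a (Fin.last n)}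

/-- Elementary algebraic subsets of a group. -/
def IsElementaryAlgebraic (S : Set G) : Prop :=
  ∃ (n : ℕ) (a : Fin (n + 1) → G) (ε : Fin (n + 1) → ℤˣ), S = solutionSet n a ε

/-- Finite unions of elementary algebraic sets (the empty union included). -/
def IsFiniteUnionElementary (S : Set G) : Prop :=
  ∃ F : Set (Set G), F.Finite ∧ (∀ E ∈ F, IsElementaryAlgebraic E) ∧ S = ⋃₀ F

/-- Algebraic subsets of a group: intersections of finite unions of elementary algebraic sets
(the empty intersection is the whole group). -/
def IsAlgebraicSet (S : Set G) : Prop :=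
  ∃ A : Set (Set G), (∀ T ∈ A, IsFiniteUnionElementary T) ∧ S = ⋂₀ A

/-- Unconditionally closed subsets of a group: those closed in every Hausdorff group topology. -/
def IsUnconditionallyClosed (S : Set G) : Prop :=
  ∀ t : TopologicalSpace G, @IsTopologicalGroup G t _ → @T2Space G t → @IsClosed G t S

theorem IsFiniteUnionElementary.union {S T : Set G} (hS : IsFiniteUnionElementary S)
    (hT : IsFiniteUnionElementary T) : IsFiniteUnionElementary (S ∪ T) := by
  obtain ⟨F, hF, hFe, rfl⟩ := hS
  obtain ⟨F', hF', hFe', rfl⟩ := hT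
  refine ⟨F ∪ F', hF.union hF', ?_, Set.sUnion_union F F' |>.symm⟩
  rintro E (h | h)
  exacts [hFe E h, hFe' E h]

theorem isAlgebraicSet_empty : IsAlgebraicSet (∅ : Set G) :=
  ⟨{∅}, by rintro T rfl; exact ⟨∅, Set.finite_empty, by simp, by simp⟩, by simp⟩

theorem isAlgebraicSet_sInter (B : Set (Set G)) (hB : ∀ S ∈ B, IsAlgebraicSet S) :
    IsAlgebraicSet (⋂₀ B) := by
  refine ⟨{T | IsFiniteUnionElementary T ∧ ⋂₀ B ⊆ T}, fun T hT => hT.1, ?_⟩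
  apply Set.Subset.antisymm
  · exact Set.subset_sInter fun T hT => hT.2
  · intro x hx S hS
    obtain ⟨A, hA, rfl⟩ := hB S hS
    intro T hT
    exact hx T ⟨hA T hT, (Set.sInter_subset_of_mem hS).trans (Set.sInter_subset_of_mem hT)⟩

theorem IsAlgebraicSet.union {S T : Set G} (hS : IsAlgebraicSet S) (hT : IsAlgebraicSet T) :
    IsAlgebraicSet (S ∪ T) := by
  obtain ⟨A, hA, rfl⟩ := hS
  obtain ⟨B, hB, rfl⟩ := hT
  refine ⟨{U | ∃ P ∈ A, ∃ Q ∈ B, U = P ∪ Q}, ?_, ?_⟩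
  · rintro U ⟨P, hP, Q, hQ, rfl⟩
    exact (hA P hP).union (hB Q hQ)
  · ext x
    constructor
    · rintro (h | h) U ⟨P, hP, Q, hQ, rfl⟩
      exacts [Or.inl (h P hP), Or.inr (h Q hQ)]
    · intro h
      by_contra hx
      simp only [Set.mem_union, Set.mem_sInter, not_or, not_forall] at hx
      obtain ⟨⟨P, hP, hxP⟩, ⟨Q, hQ, hxQ⟩⟩ := hx
      exact (h _ ⟨P, hP, Q, hQ, rfl⟩).elim hxP hxQ

variable (G) in
/-- The Zariski topology of a group: its closed sets are exactly the algebraic sets. -/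
abbrev zariskiTopology : TopologicalSpace G :=
  TopologicalSpace.ofClosed {S : Set G | IsAlgebraicSet S} isAlgebraicSet_empty
    (fun B hB => isAlgebraicSet_sInter B hB) (fun _ hS _ hT => IsAlgebraicSet.union hS hT)

variable (G) in
/-- The Markov topology of a group: the intersection of all its Hausdorff group topologies, that
is, a set is open if and only if it is open in each of them. (Mathlib orders topologies by reverse
inclusion of their families of open sets, so this infimum for inclusion is an `sSup`.) -/
abbrev markovTopology : TopologicalSpace G :=
  sSup {t : TopologicalSpace G | @IsTopologicalGroup G t _ ∧ @T2Space G t}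

theorem isClosed_zariskiTopology_iff {S : Set G} :
    @IsClosed G (zariskiTopology G) S ↔ IsAlgebraicSet S := by
  rw [← @isOpen_compl_iff G S (zariskiTopology G)]
  change IsAlgebraicSet Sᶜᶜ ↔ _
  rw [compl_compl]

theorem isClosed_markovTopology_iff {S : Set G} :
    @IsClosed G (markovTopology G) S ↔ IsUnconditionallyClosed S :=
  isClosed_sSup_iff.trans ⟨fun h t h1 h2 => h t ⟨h1, h2⟩, fun h t ht => h t ht.1 ht.2⟩

end MarkovZariski

/-! Algebraic sets are closed in every Hausdorff group topology because word maps are continuous.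
Conversely, let `x ∉ S` and put `B = x⁻¹S`, written additively. If finitely many sets `{c • y = e}`
with `e ≠ 0` cover `B`, their translates by `x` form a finite union of elementary algebraic sets
containing `S` but not `x`. Otherwise `exists_addGroupNorm_of_not_separatedFromZero` gives a norm in
which `B` accumulates at 0, so `x` lies in the closure of `S` for a Hausdorff group topology. The
norm forces a sequence in `B` to tend to 0; choosing its terms generically keeps nonzero elements
from getting norm 0. -/

namespace MarkovZariski

section Norm

variable {H : Type*} [AddCommGroup H]

/-- The admissible radii of `x` with respect to the sequence `s`: the real numbers `r ≥ 0` such that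
`r = 1` or `x` is a finite sum `∑ cₖ sₖ` with integers `|cₖ| ≤ r (k + 1)`. -/
def radii (s : ℕ → H) (x : H) : Set ℝ :=
  {r | 0 ≤ r ∧ (r = 1 ∨ ∃ c : ℕ →₀ ℤ, Finsupp.linearCombination ℤ s c = x ∧
    ∀ k, |(c k : ℝ)| ≤ r * (k + 1))}

/-- Radius 1 keeps the infimum meaningful outside the span of `s` and caps the seminorm at 1. -/
theorem one_mem_radii (s : ℕ → H) (x : H) : (1 : ℝ) ∈ radii s x := ⟨zero_le_one, Or.inl rfl⟩

theorem bddBelow_radii (s : ℕ → H) (x : H) : BddBelow (radii s x) := ⟨0, fun _ h => h.1⟩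

/-- A seminorm in which the sequence `s` tends to zero. -/
noncomputable def sequenceSeminorm (s : ℕ → H) : AddGroupSeminorm H where
  toFun x := sInf (radii s x)
  map_zero' := le_antisymm
    (csInf_le (bddBelow_radii s 0) ⟨le_rfl, Or.inr ⟨0, by simp, by simp⟩⟩)
    (le_csInf ⟨1, one_mem_radii s 0⟩ fun _ h => h.1)
  add_le' x y := by
    have key : ∀ r ∈ radii s x, ∀ q ∈ radii s y, sInf (radii s (x + y)) ≤ r + q := by
      rintro r ⟨hr, hr'⟩ q ⟨hq, hq'⟩
      have h1 := csInf_le (bddBelow_radii s (x + y)) (one_mem_radii s (x + y))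
      rcases hr' with rfl | ⟨c, rfl, hc⟩
      · linarith
      rcases hq' with rfl | ⟨d, rfl, hd⟩
      · linarith
      refine csInf_le (bddBelow_radii s _) ⟨add_nonneg hr hq, Or.inr ⟨c + d, map_add _ _ _, ?_⟩⟩
      intro k
      rw [Finsupp.add_apply, Int.cast_add, add_mul]
      exact (abs_add_le _ _).trans (add_le_add (hc k) (hd k))
    rw [← sub_le_iff_le_add]
    refine le_csInf ⟨1, one_mem_radii s x⟩ fun r hr => ?_
    rw [sub_le_comm]
    refine le_csInf ⟨1, one_mem_radii s y⟩ fun q hq => ?_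
    linarith [key r hr q hq]
  neg' x := by
    have key : ∀ y, radii s y ⊆ radii s (-y) := by
      rintro y r ⟨hr, hr'⟩
      refine ⟨hr, hr'.imp id ?_⟩
      rintro ⟨c, rfl, hc⟩
      exact ⟨-c, map_neg _ _, by simpa using hc⟩
    congr 1
    exact (by simpa using key (-x) : radii s (-x) ⊆ radii s x).antisymm (key x)

theorem sequenceSeminorm_apply_le (s : ℕ → H) (k : ℕ) :
    sequenceSeminorm s (s k) ≤ 1 / ((k : ℝ) + 1) := by
  refine csInf_le (bddBelow_radii s _) ⟨by positivity, Or.inr ⟨Finsupp.single k 1, by simp, ?_⟩⟩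
  intro j
  rcases eq_or_ne k j with rfl | h
  · rw [Finsupp.single_eq_same, one_div_mul_cancel (by positivity)]
    simp
  · rw [Finsupp.single_eq_of_ne h.symm]
    simp only [Int.cast_zero, abs_zero]
    positivity

/-- The finite sets avoided by the multiples of the terms of the sequence `fun K => g (E K) K`. -/
noncomputable def avoidedSets (g : Finset H → ℕ → H) : ℕ → Finset H
  | 0 => {0}
  | K + 1 => by
    classical
    exact (avoidedSets g K ×ˢ avoidedSets g K ×ˢ Finset.Icc (-((K : ℤ) + 1)) (K + 1)).image
      fun p => p.1 - p.2.1 + p.2.2 • g (avoidedSets g K) K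

theorem sub_add_zsmul_mem_avoidedSets (g : Finset H → ℕ → H) {K : ℕ} {e f : H}
    (he : e ∈ avoidedSets g K) (hf : f ∈ avoidedSets g K) {d : ℤ} (hd : |d| ≤ K + 1) :
    e - f + d • g (avoidedSets g K) K ∈ avoidedSets g (K + 1) := by
  classical
  rw [avoidedSets, Finset.mem_image]
  refine ⟨(e, f, d), ?_, rfl⟩
  simp only [Finset.mem_product, Finset.mem_Icc]
  exact ⟨he, hf, abs_le.1 hd⟩

theorem zero_mem_avoidedSets (g : Finset H → ℕ → H) : ∀ K, (0 : H) ∈ avoidedSets g K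
  | 0 => by simp [avoidedSets]
  | K + 1 => by
    have h := zero_mem_avoidedSets g K
    have := sub_add_zsmul_mem_avoidedSets g h h (d := 0) (by rw [abs_zero]; positivity)
    simpa using this

theorem monotone_avoidedSets (g : Finset H → ℕ → H) : Monotone (avoidedSets g) := by
  refine monotone_nat_of_le_succ fun K e he => ?_
  have := sub_add_zsmul_mem_avoidedSets g he (zero_mem_avoidedSets g K) (d := 0)
    (by rw [abs_zero]; positivity)
  simpa using this

theorem exists_linearCombination_mem_avoidedSets (g : Finset H → ℕ → H) (c : ℕ →₀ ℤ) :
    ∃ J, Finsupp.linearCombination ℤ (fun K => g (avoidedSets g K) K) c ∈ avoidedSets g J := by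
  let U : AddSubgroup H := AddSubgroup.ofSub {x | ∃ J, x ∈ avoidedSets g J}
    ⟨0, 0, zero_mem_avoidedSets g 0⟩ (by
      rintro x ⟨J, hJ⟩ y ⟨L, hL⟩
      have := sub_add_zsmul_mem_avoidedSets g (monotone_avoidedSets g (le_max_left J L) hJ)
        (monotone_avoidedSets g (le_max_right J L) hL) (d := 0) (by rw [abs_zero]; positivity)
      exact ⟨max J L + 1, by simpa [sub_eq_add_neg] using this⟩)
  have hU : ∀ K, g (avoidedSets g K) K ∈ U := fun K => ⟨K + 1, by
    have h := zero_mem_avoidedSets g K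
    have := sub_add_zsmul_mem_avoidedSets g h h (d := 1)
      (by rw [abs_one]; linarith [K.cast_nonneg (α := ℤ)])
    simpa using this⟩
  exact (U.sum_mem fun k _ => U.zsmul_mem (hU k) (c k) :)

/-- A set that cannot be covered by finitely many sets `{y | c • y = e}` in which `c` does not
annihilate the whole set accumulates at zero with respect to some norm. -/
theorem exists_addGroupNorm_of_avoidance (A : Set H)
    (hA : ∀ F : Finset (ℤ × H), (∀ p ∈ F, ∃ a ∈ A, p.1 • a ≠ 0) →
      ∃ a ∈ A, ∀ p ∈ F, p.1 • a ≠ p.2) :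
    ∃ N : AddGroupNorm H, ∀ ε > 0, ∃ a ∈ A, N a < ε := by
  classical
  have step : ∀ (E : Finset H) (K : ℕ), ∃ a ∈ A, ∀ c : ℤ, |c| ≤ K + 1 → (∃ b ∈ A, c • b ≠ 0) →
      c • a ∉ E := by
    intro E K
    obtain ⟨a, ha, h⟩ := hA (((Finset.Icc (-((K : ℤ) + 1)) (K + 1)) ×ˢ E).filter
      fun p => ∃ b ∈ A, p.1 • b ≠ 0) fun p hp => (Finset.mem_filter.1 hp).2
    refine ⟨a, ha, fun c hc hb hE => h (c, c • a) ?_ rfl⟩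
    simp only [Finset.mem_filter, Finset.mem_product, Finset.mem_Icc]
    exact ⟨⟨abs_le.1 hc, hE⟩, hb⟩
  choose g hgA hg using step
  set s : ℕ → H := fun K => g (avoidedSets g K) K with hs
  refine ⟨{ sequenceSeminorm s with eq_zero_of_map_eq_zero' := ?_ }, ?_⟩
  · intro x hx
    change sInf (radii s x) = 0 at hx
    have small : ∀ ε : ℝ, 0 < ε → ε ≤ 1 → ∃ c : ℕ →₀ ℤ, Finsupp.linearCombination ℤ s c = x ∧
        ∀ k, |(c k : ℝ)| < ε * (k + 1) := by
      intro ε hε hε1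
      obtain ⟨r, ⟨-, hr⟩, hrε⟩ :=
        exists_lt_of_csInf_lt ⟨1, one_mem_radii s x⟩ (hx.trans_lt hε)
      rcases hr with rfl | ⟨c, hc, hck⟩
      · exact absurd hrε hε1.not_gt
      · exact ⟨c, hc, fun k => (hck k).trans_lt (by gcongr)⟩
    obtain ⟨J, hJ⟩ : ∃ J, x ∈ avoidedSets g J := by
      obtain ⟨c, rfl, -⟩ := small 1 one_pos le_rfl
      exact exists_linearCombination_mem_avoidedSets g c
    have hJ0 : (0 : ℝ) < J + 1 := by positivity
    -- This radius kills all coefficients below `J`, so peeling terms off `x` can start inside stage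
    -- `J`.
    obtain ⟨c, hcx, hc⟩ := small (1 / (J + 1)) (by positivity)
      (by rw [div_le_one hJ0]; linarith [J.cast_nonneg (α := ℝ)])
    have hc0 : ∀ k < J, c k = 0 := by
      intro k hk
      have h1 : |(c k : ℝ)| < 1 := by
        refine (hc k).trans_le ?_
        rw [one_div, inv_mul_le_iff₀ hJ0, mul_one]
        exact_mod_cast Nat.succ_le_succ hk.le
      exact Int.abs_lt_one_iff.1 (by exact_mod_cast h1)
    have hcle : ∀ k : ℕ, |c k| ≤ (k : ℤ) + 1 := by
      intro k
      have h1 : |(c k : ℝ)| ≤ k + 1 := by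
        refine (hc k).le.trans (mul_le_of_le_one_left (by positivity) ?_)
        rw [div_le_one hJ0]; linarith [J.cast_nonneg (α := ℝ)]
      exact_mod_cast h1
    have hsmall : ∀ K ≤ J, ∑ k ∈ Finset.range K, c k • s k = 0 := fun K hK =>
      Finset.sum_eq_zero fun k hk => by
        rw [hc0 k ((Finset.mem_range.1 hk).trans_le hK), zero_smul]
    have hmem : ∀ K, J ≤ K → x - ∑ k ∈ Finset.range K, c k • s k ∈ avoidedSets g K := by
      intro K hK
      induction K, hK using Nat.le_induction with
      | base => rwa [hsmall J le_rfl, sub_zero]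
      | succ K hK ih =>
        have := sub_add_zsmul_mem_avoidedSets g ih (zero_mem_avoidedSets g K) (d := -c K)
          (by rw [abs_neg]; exact hcle K)
        rw [Finset.sum_range_succ]
        convert this using 1
        rw [neg_smul, sub_zero]
        abel
    -- Take the shortest partial sum equal to `x`. If it is longer than `J`, its last term lies in
    -- the finite set it was chosen to avoid, so its coefficient annihilates `A` and the term can be
    -- dropped.
    have hex : ∃ K, x = ∑ k ∈ Finset.range K, c k • s k := by
      obtain ⟨K, hK⟩ := c.support.exists_nat_subset_range
      refine ⟨K, ?_⟩
      rw [← hcx, Finsupp.linearCombination_apply]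
      exact Finsupp.sum_of_support_subset c hK _ (by simp)
    have hspec := Nat.find_spec hex
    rcases le_or_gt (Nat.find hex) J with hle | hlt
    · rw [hspec, hsmall _ hle]
    obtain ⟨K, hK⟩ : ∃ K, Nat.find hex = K + 1 := Nat.exists_eq_succ_of_ne_zero (by omega)
    have hJK : J ≤ K := by omega
    rw [hK, Finset.sum_range_succ] at hspec
    have hin := hmem K hJK
    rw [sub_eq_of_eq_add' hspec] at hin
    have hann : c K • s K = 0 := by
      by_contra hne
      exact hg _ K (c K) (hcle K) ⟨s K, hgA _ _, hne⟩ hin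
    rw [hann, add_zero] at hspec
    exact absurd (Nat.find_min' hex hspec) (by omega)
  · intro ε hε
    obtain ⟨k, hk⟩ := exists_nat_one_div_lt hε
    exact ⟨s k, hgA _ _, (sequenceSeminorm_apply_le s k).trans_lt hk⟩

/-- A set is separated from zero by equations if it is covered by finitely many sets
`{y | c • y = e}` with `e ≠ 0`. -/
def SeparatedFromZero (B : Set H) : Prop :=
  ∃ F : Finset (ℤ × H), (∀ p ∈ F, p.2 ≠ 0) ∧ ∀ b ∈ B, ∃ p ∈ F, p.1 • b = p.2

theorem separatedFromZero_of_finset_cover {B : Set H} {ι : Type*} (F : Finset ι) (C : ι → Set H)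
    (hC : ∀ i ∈ F, SeparatedFromZero (C i)) (hB : ∀ b ∈ B, ∃ i ∈ F, b ∈ C i) :
    SeparatedFromZero B := by
  classical
  choose! T hT0 hT using hC
  refine ⟨F.biUnion T, ?_, ?_⟩
  · intro p hp
    obtain ⟨i, hi, hp⟩ := Finset.mem_biUnion.1 hp
    exact hT0 i hi p hp
  · intro b hb
    obtain ⟨i, hi, hbi⟩ := hB b hb
    obtain ⟨p, hp, h⟩ := hT i hi b hbi
    exact ⟨p, Finset.mem_biUnion.2 ⟨i, hi, hp⟩, h⟩

/-- The ideal of integers annihilating every element of a set. -/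
def integerAnnihilator (B : Set H) : Ideal ℤ where
  carrier := {c | ∀ b ∈ B, c • b = 0}
  add_mem' hc hd b hb := by rw [add_smul, hc b hb, hd b hb, add_zero]
  zero_mem' b _ := zero_smul ℤ b
  smul_mem' c d hd b hb := by rw [smul_eq_mul, mul_smul, hd b hb, smul_zero]

/-- As ℤ is Noetherian, some non-separated `A ⊆ B` has maximal annihilator. If `c` does not
annihilate `A`, the part of `A` killed by `c` has a larger annihilator, hence is separated. So a
cover excluded by the avoidance hypothesis would separate `A`. -/
theorem exists_addGroupNorm_of_not_separatedFromZero {B : Set H} (hB : ¬ SeparatedFromZero B) :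
    ∃ N : AddGroupNorm H, ∀ ε > 0, ∃ b ∈ B, N b < ε := by
  obtain ⟨I, ⟨A, hAB, hA, rfl⟩, hmax⟩ := set_has_maximal_iff_noetherian.2
    (inferInstance : IsNoetherian ℤ ℤ)
    {I : Ideal ℤ | ∃ A ⊆ B, ¬ SeparatedFromZero A ∧ integerAnnihilator A = I}
    ⟨_, B, subset_rfl, hB, rfl⟩
  obtain ⟨N, hN⟩ := exists_addGroupNorm_of_avoidance A (by
    intro F hF
    by_contra! hcov
    refine hA (separatedFromZero_of_finset_cover F (fun p => {a ∈ A | p.1 • a = p.2}) ?_ ?_)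
    · rintro ⟨c, e⟩ hp
      rcases eq_or_ne e 0 with rfl | he
      · by_contra hsep
        refine hmax _ ⟨_, (Set.sep_subset _ _).trans hAB, hsep, rfl⟩
          (SetLike.lt_iff_le_and_exists.2 ⟨fun d hd b hb => hd b hb.1, c, fun b hb => hb.2, ?_⟩)
        intro hc
        obtain ⟨a, ha, hne⟩ := hF _ hp
        exact hne (hc a ha)
      · exact ⟨{(c, e)}, by simpa using he, fun b hb => ⟨(c, e), by simp, hb.2⟩⟩
    · intro a ha
      obtain ⟨p, hp, h⟩ := hcov a ha
      exact ⟨p, hp, ha, h⟩)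
  exact ⟨N, fun ε hε => (hN ε hε).imp fun a ha => ⟨hAB ha.1, ha.2⟩⟩

end Norm

theorem IsElementaryAlgebraic.isClosed {G : Type*} [Group G] [TopologicalSpace G]
    [IsTopologicalGroup G] [T2Space G] {S : Set G} (hS : IsElementaryAlgebraic S) :
    IsClosed S := by
  obtain ⟨n, a, ε, rfl⟩ := hS
  refine isClosed_eq (Continuous.mul ?_ (continuous_zpow _)) continuous_const
  simp_rw [List.ofFn_eq_map]
  exact continuous_list_prod _ fun i _ => (continuous_zpow _).mul continuous_const

theorem IsAlgebraicSet.isUnconditionallyClosed {G : Type*} [Group G] {S : Set G}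
    (hS : IsAlgebraicSet S) : IsUnconditionallyClosed S := by
  intro t _ _
  obtain ⟨A, hA, rfl⟩ := hS
  refine isClosed_sInter fun T hT => ?_
  obtain ⟨F, hF, hFe, rfl⟩ := hA T hT
  rw [Set.sUnion_eq_biUnion]
  exact hF.isClosed_biUnion fun E hE => (hFe E hE).isClosed

section Comm

variable {G : Type*} [CommGroup G]

theorem isElementaryAlgebraic_zpow_eq (c : ℤ) (g : G) :
    IsElementaryAlgebraic {y : G | y ^ c = g} := by
  have key : ∀ (m : ℕ) (u : ℤˣ),
      IsElementaryAlgebraic {y : G | y ^ ((u : ℤ) * (m + 1)) = g} := by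
    intro m u
    refine ⟨m, fun i => if i = Fin.last m then g else 1, fun _ => u, ?_⟩
    ext y
    simp [solutionSet, Fin.ext_iff, zpow_mul, zpow_add, pow_succ, (Fin.is_lt _).ne]
  rcases c with (_ | m) | m
  -- Words are nonempty, so exponent 0 is realised as `y * 1 * y⁻¹`.
  · refine ⟨1, ![1, g], ![1, -1], ?_⟩
    ext y
    simp [solutionSet]
  · simpa using key m 1
  · simpa [Int.negSucc_eq] using key m (-1)

/-- A set of an Abelian group is closed in all Hausdorff group topologies only if each point outside
it is separated from it by a finite union of elementary algebraic sets. -/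
theorem IsUnconditionallyClosed.exists_isFiniteUnionElementary {S : Set G}
    (hS : IsUnconditionallyClosed S) {x : G} (hx : x ∉ S) :
    ∃ T, IsFiniteUnionElementary T ∧ S ⊆ T ∧ x ∉ T := by
  by_cases hsep : SeparatedFromZero {b : Additive G | x * b.toMul ∈ S}
  · obtain ⟨F, hF0, hF⟩ := hsep
    refine ⟨⋃₀ ((fun p : ℤ × Additive G => {y : G | y ^ p.1 = x ^ p.1 * p.2.toMul}) '' F),
      ⟨_, F.finite_toSet.image _, ?_, rfl⟩, ?_, ?_⟩
    · rintro _ ⟨p, -, rfl⟩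
      exact isElementaryAlgebraic_zpow_eq _ _
    · intro y hy
      obtain ⟨p, hp, h⟩ := hF (Additive.ofMul (x⁻¹ * y)) (by simpa using hy)
      refine ⟨_, ⟨p, hp, rfl⟩, ?_⟩
      change y ^ p.1 = x ^ p.1 * p.2.toMul
      rw [← h, toMul_zsmul, toMul_ofMul, ← mul_zpow, mul_inv_cancel_left]
    · rintro ⟨_, ⟨p, hp, rfl⟩, h⟩
      exact hF0 p hp (toMul_eq_one.1 (mul_eq_left.1 (Eq.symm h)))
  · obtain ⟨N, hN⟩ := exists_addGroupNorm_of_not_separatedFromZero hsep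
    let M : GroupNorm G :=
      { toFun := fun y => N (Additive.ofMul y)
        map_one' := map_zero N
        mul_le' := fun y z => map_add_le_add N (Additive.ofMul y) (Additive.ofMul z)
        inv' := fun y => map_neg_eq_map N (Additive.ofMul y)
        eq_one_of_map_eq_zero' := fun y hy =>
          ofMul_eq_zero.1 (eq_zero_of_map_eq_zero N hy) }
    let _ : NormedCommGroup G := M.toNormedCommGroup
    have hcl : IsClosed S := hS _ inferInstance inferInstance
    refine absurd (hcl.closure_subset (Metric.mem_closure_iff.2 fun ε hε => ?_)) hx
    obtain ⟨b, hb, hbε⟩ := hN ε hε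
    refine ⟨_, hb, ?_⟩
    rw [dist_eq_norm_inv_mul, inv_mul_cancel_left]
    exact hbε

theorem IsUnconditionallyClosed.isAlgebraicSet {S : Set G} (hS : IsUnconditionallyClosed S) :
    IsAlgebraicSet S := by
  refine ⟨{T | IsFiniteUnionElementary T ∧ S ⊆ T}, fun T hT => hT.1, ?_⟩
  refine (Set.subset_sInter fun T hT => hT.2).antisymm fun x hx => ?_
  by_contra hxS
  obtain ⟨T, hT, hST, hxT⟩ := hS.exists_isFiniteUnionElementary hxS
  exact hxT (hx T ⟨hT, hST⟩)

end Comm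

end MarkovZariski

/-- On every Abelian group, the Markov topology and the Zariski topology coincide. -/
theorem corollary4p4 (G : Type*) [CommGroup G] :
    MarkovZariski.markovTopology G = MarkovZariski.zariskiTopology G := by
  refine TopologicalSpace.ext_isClosed fun S => ?_
  rw [MarkovZariski.isClosed_markovTopology_iff, MarkovZariski.isClosed_zariskiTopology_iff]
  exact ⟨fun h => h.isAlgebraicSet, fun h => h.isUnconditionallyClosed⟩
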